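/- Let $c>1$ be a constant. Then there are constants $0<\alpha<1<\beta$, depending only on $c$, such that the following holds. Let $d=d(n)$ be real numbers with $d\le n$ for all $n \ge 1$ and $d\ge c\log n$ for all sufficiently large $n$, let $p=d/n$, and let $G=G(n,p)$ be the binomial random graph on $n$ vertices. For a vertex $w$ and an integer $t\ge 0$ let $V_t(w)$ be the set of vertices at shortest-path distance exactly $t$ from $w$. Let $t^*=t^*(n)$ be any sequence of non-negative integers with $d^{t^*}=o(n)$ as $n\to\infty$ (in particular, the largest such sequence, if there is one). Then for every fixed $\varepsilon>0$, with probability tending to $1$ as $n\to\infty$, the following hold simultaneously for all vertices $w$: $$(1-\varepsilon)\,\alpha d\le \deg w\le(1+\varepsilon)\,\beta d ,$$ $$(1-\varepsilon)\,d^{t-1}\deg w\le |V_t(w)|\le(1+\varepsilon)\,d^{t-1}\deg w\quad\text{for all }1\le t\le t^*,$$ $$(1-\varepsilon)\,\alpha d^{t}\le |V_t(w)|\le(1+\varepsilon)\,\beta d^{t}\quad\text{for all }0\le t\le t^*.$$ Moreover, if $d=\omega(\log n)$, the same holds with $\alpha=\beta=1$. -/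

import Mathlib

open Filter Topology Asymptotics

namespace ShellGrowth

/-- The shell `V_t(w)`: the vertices whose shortest-path distance from `w` is exactly `t`.
The distance takes values in `ℕ∞`, so an unreachable vertex lies in no shell. -/
def shell {V : Type*} (G : SimpleGraph V) (w : V) (t : ℕ) : Set V :=
  {v | G.edist w v = (t : ℕ∞)}

open Classical in
/-- The degree of `w`, as a real number. -/
noncomputable def deg {V : Type*} [Fintype V] (G : SimpleGraph V) (w : V) : ℝ :=
  (G.degree w : ℝ)

/-- A sequence of graph properties `E n` holds with high probability in `G(n, p n)`. -/
def WHP (p : ℕ → unitInterval) (E : (n : ℕ) → SimpleGraph (Fin n) → Prop) : Prop :=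
  Tendsto (fun n => SimpleGraph.binomialRandom (Fin n) (p n) {G | E n G}) atTop (𝓝 1)

/-- Every vertex `w` of `G` has degree between `α d` and `β d`, its shells satisfy
`|V_t(w)| = d ^ (t - 1) * deg w` for `1 ≤ t ≤ T` and `α d ^ t ≤ |V_t(w)| ≤ β d ^ t` for `t ≤ T`,
each up to a factor `1 ± ε`. -/
def Expands {V : Type*} [Fintype V] (G : SimpleGraph V) (d : ℝ) (T : ℕ) (α β ε : ℝ) : Prop :=
  ∀ w : V,
    ((1 - ε) * (α * d) ≤ deg G w ∧ deg G w ≤ (1 + ε) * (β * d)) ∧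
    (∀ t : ℕ, 1 ≤ t → t ≤ T →
      (1 - ε) * (d ^ (t - 1) * deg G w) ≤ ((shell G w t).ncard : ℝ) ∧
      ((shell G w t).ncard : ℝ) ≤ (1 + ε) * (d ^ (t - 1) * deg G w)) ∧
    (∀ t : ℕ, t ≤ T →
      (1 - ε) * (α * d ^ t) ≤ ((shell G w t).ncard : ℝ) ∧
      ((shell G w t).ncard : ℝ) ≤ (1 + ε) * (β * d ^ t))

end ShellGrowth

open ProbabilityTheory MeasureTheory Measure unitInterval

namespace ShellGrowth
-- Explore the graph from `w` by breadth-first search. The layers up to time t are determined by the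
-- edges that meet a vertex at distance less than t (`layers_congr`). The edges from the current
-- layer S to the unexplored set U are therefore still fresh, and the size of the next layer is
-- binomial with mean |U|(1-(1-p)^|S|), which is close to d|S| while few vertices are explored. A
-- Chernoff bound then holds whatever the history was (`real_layers_le`, `real_next_layer_le`).
--
-- The relative error at step t is split into a random part ε2^{-t} and a depletion part
-- ε2^{-(T-t)}. The first is affordable because layers grow like d^t, the second because d^T = o(n)
-- makes the explored fraction shrink geometrically going back from T. Each part sums to at most ε,
-- so the total error is bounded uniformly in T (`growth`, `expands_of_step`). From layer 1 on, a
-- step fails with probability exp(-Ω(d²)), which survives a union bound over all vertices and steps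
-- because d ≥ log n (`real_not_expands_le`, `whp_expands`).
--
-- Only the degrees are delicate, since their tails are merely exponential in d: c > 1 and a small
-- enough α bring them below n^{-1-γ}, and when d = ω(log n) every fixed relative deviation is that
-- unlikely.
instance {V : Type*} [Finite V] : DiscreteMeasurableSpace (SimpleGraph V) where
  forall_measurableSet s := by
    have := SimpleGraph.measurableEmbedding_edgeSet (V := V)
    rw [← Set.preimage_image_eq s this.injective]
    exact this.measurable (Set.toFinite _).measurableSet

/-! ### Edge sets and neighbourhoods -/

section Edges

variable {V : Type*}

/-- The edges with one end in `S` and the other in `U`. -/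
def edgesBetween (S U : Set V) : Set (Sym2 V) := {e | ∃ s ∈ S, ∃ u ∈ U, e = s(s, u)}

/-- An unordered pair can match in two orientations; each hypothesis blocks one of them. -/
lemma disjoint_edgesBetween {S U S' U' : Set V} (h1 : Disjoint S S' ∨ Disjoint U U')
    (h2 : Disjoint S U' ∨ Disjoint U S') :
    Disjoint (edgesBetween S U) (edgesBetween S' U') := by
  rw [Set.disjoint_left]
  rintro _ ⟨s, hs, u, hu, rfl⟩ ⟨s', hs', u', hu', h⟩
  simp only [Sym2.eq_iff] at h
  simp only [Set.disjoint_left] at h1 h2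
  grind

open Classical in
/-- The vertices of `U` with a neighbour in `S`. -/
noncomputable def nbrs (G : SimpleGraph V) (S U : Finset V) : Finset V :=
  U.filter fun u => ∃ s ∈ S, G.Adj s u

lemma nbrs_congr {G G' : SimpleGraph V} {S U : Finset V}
    (h : ∀ e ∈ edgesBetween (S : Set V) U, e ∈ G.edgeSet ↔ e ∈ G'.edgeSet) :
    nbrs G S U = nbrs G' S U := by
  classical
  refine Finset.filter_congr fun u hu => exists_congr fun s => and_congr_right fun hs => ?_
  exact h s(s, u) ⟨s, hs, u, hu, rfl⟩

end Edges

/-! ### Independence of edges and Chernoff bounds for neighbourhoods -/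

section RandomGraph

variable {V : Type*} [Fintype V] (p : unitInterval)

lemma hasLaw_mem_edgeSet :
    HasLaw (fun (G : SimpleGraph V) (e : Sym2 V) => e ∈ G.edgeSet)
      (infinitePi fun e : Sym2 V =>
        toNNReal p • dirac (e ∈ (Sym2.diagSetᶜ : Set (Sym2 V))) + toNNReal (σ p) • dirac False)
      (SimpleGraph.binomialRandom V p) where
  aemeasurable := Measurable.of_discrete.aemeasurable
  map_eq := by
    have h1 : (SimpleGraph.binomialRandom V p).map SimpleGraph.edgeSet
        = setBernoulli (Sym2.diagSetᶜ) p := by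
      -- Pulling back along `edgeSet` and pushing forward again restricts to its range, which
      -- carries full measure because almost every sampled set avoids the diagonal.
      rw [SimpleGraph.binomialRandom, SimpleGraph.measurableEmbedding_edgeSet.map_comap,
        restrict_eq_self_of_ae_mem]
      filter_upwards [setBernoulli_ae_subset] with S hS
      exact ⟨SimpleGraph.fromEdgeSet S, by
        simpa [← Set.compl_ofPred, Set.subset_compl_iff_disjoint_right] using hS⟩
    have h2 : (fun (G : SimpleGraph V) (e : Sym2 V) => e ∈ G.edgeSet)
      = (fun (s : Set (Sym2 V)) e => e ∈ s) ∘ SimpleGraph.edgeSet := rfl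
    rw [h2, ← Measure.map_map (by fun_prop) (by fun_prop), h1, setBernoulli_eq_map,
      Measure.map_map (by fun_prop) (by fun_prop)]
    exact Measure.map_id

lemma hasLaw_mem_edgeSet_apply (e : Sym2 V) :
    HasLaw (fun (G : SimpleGraph V) => e ∈ G.edgeSet)
      (toNNReal p • dirac (e ∈ (Sym2.diagSetᶜ : Set (Sym2 V))) + toNNReal (σ p) • dirac False)
      (SimpleGraph.binomialRandom V p) where
  aemeasurable := Measurable.of_discrete.aemeasurable
  map_eq := by
    have h := (hasLaw_mem_edgeSet (V := V) p).map_eq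
    have h2 : (fun (G : SimpleGraph V) => e ∈ G.edgeSet)
      = (fun (f : Sym2 V → Prop) => f e) ∘ fun G e => e ∈ G.edgeSet := rfl
    rw [h2, ← Measure.map_map (by fun_prop) .of_discrete, h]
    exact infinitePi_map_eval _ e

lemma iIndepFun_mem_edgeSet :
    iIndepFun (fun (e : Sym2 V) (G : SimpleGraph V) => e ∈ G.edgeSet)
      (SimpleGraph.binomialRandom V p) :=
  (iIndepFun_iff_hasLaw_Pi_infinitePi (fun e => hasLaw_mem_edgeSet_apply p e)
    Measurable.of_discrete.aemeasurable).2 (hasLaw_mem_edgeSet p)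

lemma real_adj_compl {u v : V} (h : u ≠ v) :
    (SimpleGraph.binomialRandom V p).real {G | ¬ G.Adj u v} = 1 - p := by
  have := (hasLaw_mem_edgeSet_apply p s(u, v)).map_eq
  have h2 : {G : SimpleGraph V | ¬ G.Adj u v} = (fun G : SimpleGraph V => s(u, v) ∈ G.edgeSet) ⁻¹' {False} := by
    ext G; simp
  rw [h2, ← map_measureReal_apply .of_discrete .of_discrete, this]
  simp [h, Measure.real]

open Classical in
lemma exists_eq_comp_edges {β : Type*} [Nonempty β] (E : Set (Sym2 V)) {X : SimpleGraph V → β}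
    (hX : ∀ G G' : SimpleGraph V, (∀ e ∈ E, e ∈ G.edgeSet ↔ e ∈ G'.edgeSet) → X G = X G') :
    ∃ φ : ((e : E.toFinset) → Prop) → β, X = φ ∘ fun G e => (e : Sym2 V) ∈ G.edgeSet := by
  let r : SimpleGraph V → ((e : E.toFinset) → Prop) := fun G e => (e : Sym2 V) ∈ G.edgeSet
  refine ⟨fun ω => X (Function.invFun r ω), ?_⟩
  ext G
  refine hX _ _ fun e he => ?_
  have h1 : r (Function.invFun r (r G)) = r G := Function.invFun_eq ⟨G, rfl⟩
  have h2 := congrFun h1 ⟨e, by simpa using he⟩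
  exact (iff_of_eq h2).symm

/-- Random variables that depend on disjoint sets of edges are independent. -/
lemma indepFun_of_disjoint_edges {β γ : Type*} [MeasurableSpace β] [MeasurableSpace γ] [Nonempty β]
    [Nonempty γ] {E F : Set (Sym2 V)} (hEF : Disjoint E F) {X : SimpleGraph V → β}
    {Y : SimpleGraph V → γ}
    (hX : ∀ G G' : SimpleGraph V, (∀ e ∈ E, e ∈ G.edgeSet ↔ e ∈ G'.edgeSet) → X G = X G')
    (hY : ∀ G G' : SimpleGraph V, (∀ e ∈ F, e ∈ G.edgeSet ↔ e ∈ G'.edgeSet) → Y G = Y G') :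
    IndepFun X Y (SimpleGraph.binomialRandom V p) := by
  classical
  have h := (iIndepFun_mem_edgeSet (V := V) p).indepFun_finset E.toFinset F.toFinset
    (by simpa using hEF) (fun _ => .of_discrete)
  obtain ⟨φ, rfl⟩ := exists_eq_comp_edges E hX
  obtain ⟨ψ, rfl⟩ := exists_eq_comp_edges F hY
  exact h.comp .of_discrete .of_discrete

/-- Events that depend on disjoint sets of edges are independent. -/
lemma real_inter_of_disjoint_edges {E F : Set (Sym2 V)} (hEF : Disjoint E F)
    {P Q : SimpleGraph V → Prop}
    (hP : ∀ G G' : SimpleGraph V, (∀ e ∈ E, e ∈ G.edgeSet ↔ e ∈ G'.edgeSet) → P G = P G')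
    (hQ : ∀ G G' : SimpleGraph V, (∀ e ∈ F, e ∈ G.edgeSet ↔ e ∈ G'.edgeSet) → Q G = Q G') :
    (SimpleGraph.binomialRandom V p).real {G | P G ∧ Q G} =
    (SimpleGraph.binomialRandom V p).real {G | P G} *
    (SimpleGraph.binomialRandom V p).real {G | Q G} := by
  have h := (indepFun_of_disjoint_edges p hEF hP hQ).measure_inter_preimage_eq_mul {True} {True}
    .of_discrete .of_discrete
  have h' := congrArg ENNReal.toReal h
  rw [ENNReal.toReal_mul] at h'
  have e (R : SimpleGraph V → Prop) : R ⁻¹' {True} = {G | R G} := by ext; simp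
  simp only [e] at h'
  exact h'

open Classical in
lemma real_forall_not_adj (S : Finset V) (u : V) (hu : u ∉ S) :
    (SimpleGraph.binomialRandom V p).real {G | ∀ s ∈ S, ¬ G.Adj s u} = (1 - p : ℝ) ^ S.card := by
  induction S using Finset.induction_on with
  | empty => simp
  | insert a S ha ih =>
    simp only [Finset.mem_insert, not_or] at hu
    have := real_inter_of_disjoint_edges p (E := edgesBetween {a} {u}) (F := edgesBetween S {u})
      (disjoint_edgesBetween (by simp [ha]) (by simp [Ne.symm hu.1]))
      (P := fun G => ¬ G.Adj a u) (Q := fun G => ∀ s ∈ S, ¬ G.Adj s u)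
      (by
        intro G G' h
        have := h s(a, u) ⟨a, rfl, u, rfl, rfl⟩
        simp only [SimpleGraph.mem_edgeSet] at this
        simp [this])
      (by
        intro G G' h
        refine propext (forall₂_congr fun s hs => ?_)
        have := h s(s, u) ⟨s, hs, u, rfl, rfl⟩
        simp only [SimpleGraph.mem_edgeSet] at this
        simp [this])
    simp only [Finset.forall_mem_insert]
    rw [this, ih hu.2, real_adj_compl p (Ne.symm hu.1), Finset.card_insert_of_notMem ha, pow_succ']

lemma mgf_indicator (P : SimpleGraph V → Prop) [DecidablePred P] (t : ℝ) :
    mgf (fun G => if P G then 1 else 0) (SimpleGraph.binomialRandom V p) t =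
      1 + (SimpleGraph.binomialRandom V p).real {G | P G} * (Real.exp t - 1) := by
  have h : ∀ G, Real.exp (t * if P G then 1 else 0) =
      1 + {G | P G}.indicator (fun _ => Real.exp t - 1) G := by
    intro G
    by_cases hG : P G <;> simp [hG]
  simp only [mgf, h]
  rw [integral_add .of_finite .of_finite, integral_indicator .of_discrete]
  simp

open Classical in
-- Vertices of `U` see disjoint sets of edges to `S`, so the count is a sum of independent
-- indicators, each of mean 1-(1-p)^|S|.
lemma mgf_card_nbrs (S U : Finset V) (hSU : Disjoint S U) (t : ℝ) :
    mgf (fun G => ((nbrs G S U).card : ℝ)) (SimpleGraph.binomialRandom V p) t =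
      (1 + (1 - (1 - p : ℝ) ^ S.card) * (Real.exp t - 1)) ^ U.card := by
  induction U using Finset.induction_on with
  | empty => simp [nbrs]
  | insert u U hu ih =>
    rw [Finset.disjoint_insert_right] at hSU
    have hind := indepFun_of_disjoint_edges p (E := edgesBetween S {u}) (F := edgesBetween S U)
      (disjoint_edgesBetween (by simp [hu]) (by simp [hSU.1]))
      (X := fun G => if ∃ s ∈ S, G.Adj s u then (1 : ℝ) else 0)
      (Y := fun G => ((nbrs G S U).card : ℝ))
      (by
        intro G G' h
        have : (∃ s ∈ S, G.Adj s u) ↔ ∃ s ∈ S, G'.Adj s u :=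
          exists_congr fun s => and_congr_right fun hs => h s(s, u) ⟨s, hs, u, rfl, rfl⟩
        simp only [this])
      (by
        intro G G' h
        simp only [nbrs_congr h])
    have hsum : (fun G => ((nbrs G S (insert u U)).card : ℝ)) =
        (fun G => if ∃ s ∈ S, G.Adj s u then (1 : ℝ) else 0) +
          fun G => ((nbrs G S U).card : ℝ) := by
      ext G
      simp only [nbrs, Finset.filter_insert, Pi.add_apply]
      split_ifs with h
      · rw [Finset.card_insert_of_notMem (by simp [hu])]
        push_cast
        ring
      · simp
    have hP : (SimpleGraph.binomialRandom V p).real {G | ∃ s ∈ S, G.Adj s u} =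
        1 - (1 - p : ℝ) ^ S.card := by
      rw [← real_forall_not_adj p S u hSU.1, ← probReal_compl_eq_one_sub .of_discrete]
      congr 1
      ext G
      simp
    rw [hsum, hind.mgf_add Measurable.of_discrete.aestronglyMeasurable
      Measurable.of_discrete.aestronglyMeasurable, ih hSU.2, mgf_indicator, hP,
      Finset.card_insert_of_notMem hu, pow_succ']

lemma mgf_card_nbrs_le (S U : Finset V) (hSU : Disjoint S U) (t : ℝ) :
    mgf (fun G => ((nbrs G S U).card : ℝ)) (SimpleGraph.binomialRandom V p) t ≤
      Real.exp (U.card * (1 - (1 - p : ℝ) ^ S.card) * (Real.exp t - 1)) := by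
  rw [mgf_card_nbrs p S U hSU, mul_assoc, Real.exp_nat_mul]
  have h0 : (0 : ℝ) ≤ 1 - p := by have := p.2.2; linarith
  have h1 : (1 - p : ℝ) ≤ 1 := by have := p.2.1; linarith
  have h2 := pow_le_one₀ (n := S.card) h0 h1
  have h3 := pow_nonneg h0 S.card
  refine pow_le_pow_left₀ ?_ ?_ _
  · nlinarith [Real.exp_pos t]
  · linarith [Real.add_one_le_exp ((1 - (1 - p : ℝ) ^ S.card) * (Real.exp t - 1))]

/-- Upper tail of the number of neighbours. -/
lemma real_le_card_nbrs (S U : Finset V) (hSU : Disjoint S U) {t m : ℝ}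
    (ht : 0 ≤ t) (hm : U.card * (1 - (1 - p : ℝ) ^ S.card) ≤ m) (a : ℝ) :
    (SimpleGraph.binomialRandom V p).real {G | a ≤ (nbrs G S U).card} ≤
      Real.exp (-t * a + m * (Real.exp t - 1)) := by
  refine (measure_ge_le_exp_mul_mgf a ht .of_finite).trans ?_
  rw [Real.exp_add]
  gcongr
  refine (mgf_card_nbrs_le p S U hSU t).trans (Real.exp_le_exp.2 ?_)
  exact mul_le_mul_of_nonneg_right hm (by linarith [Real.one_le_exp ht])

/-- Lower tail of the number of neighbours. -/
lemma real_card_nbrs_le (S U : Finset V) (hSU : Disjoint S U) {t m : ℝ}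
    (ht : 0 ≤ t) (hm : m ≤ U.card * (1 - (1 - p : ℝ) ^ S.card)) (a : ℝ) :
    (SimpleGraph.binomialRandom V p).real {G | ((nbrs G S U).card : ℝ) ≤ a} ≤
      Real.exp (t * a - m * (1 - Real.exp (-t))) := by
  refine (measure_le_le_exp_mul_mgf a (t := -t) (by linarith) .of_finite).trans ?_
  rw [neg_neg, sub_eq_add_neg, Real.exp_add]
  gcongr
  refine (mgf_card_nbrs_le p S U hSU (-t)).trans (Real.exp_le_exp.2 ?_)
  have : Real.exp (-t) ≤ 1 := Real.exp_le_one_iff.2 (by linarith)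
  nlinarith

/-- Two-sided concentration of the number of neighbours. -/
lemma real_card_nbrs_deviation (S U : Finset V) (hSU : Disjoint S U)
    {δ m M : ℝ} (h0 : 0 ≤ δ) (h1 : δ ≤ 1) (hm0 : 0 ≤ m)
    (hm : m ≤ U.card * (1 - (1 - p : ℝ) ^ S.card))
    (hM : U.card * (1 - (1 - p : ℝ) ^ S.card) ≤ M) :
    (SimpleGraph.binomialRandom V p).real {G | ¬ ((1 - δ) * m ≤ (nbrs G S U).card ∧
      ((nbrs G S U).card : ℝ) ≤ (1 + δ) * M)} ≤ 2 * Real.exp (-(δ ^ 2 * m / 4)) := by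
  have hsub : {G | ¬ ((1 - δ) * m ≤ (nbrs G S U).card ∧
      ((nbrs G S U).card : ℝ) ≤ (1 + δ) * M)} ⊆
      {G | ((nbrs G S U).card : ℝ) ≤ (1 - δ) * m} ∪ {G | (1 + δ) * M ≤ (nbrs G S U).card} := by
    intro G hG
    simp only [Set.mem_ofPred_eq, not_and_or, not_le] at hG
    exact hG.imp le_of_lt le_of_lt
  refine (measureReal_mono hsub).trans ((measureReal_union_le _ _).trans ?_)
  -- With e^x ≤ 1 + x + x², the parameter x = ±δ/2 minimises -δ|x| + x², which gives the exponent
  -- -δ²/4.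
  have hp := Real.abs_exp_sub_one_sub_id_le (x := δ / 2) (by rw [abs_le]; constructor <;> linarith)
  have hn := Real.abs_exp_sub_one_sub_id_le (x := -(δ / 2))
    (by rw [abs_le]; constructor <;> linarith)
  have hp' := (abs_le.1 hp).2
  have hn' := (abs_le.1 hn).2
  have e1 : (SimpleGraph.binomialRandom V p).real {G | ((nbrs G S U).card : ℝ) ≤ (1 - δ) * m} ≤
      Real.exp (-(δ ^ 2 * m / 4)) := by
    refine (real_card_nbrs_le p S U hSU (t := δ / 2) (by linarith) hm _).trans
      (Real.exp_le_exp.2 ?_)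
    nlinarith
  have e2 : (SimpleGraph.binomialRandom V p).real {G | (1 + δ) * M ≤ (nbrs G S U).card} ≤
      Real.exp (-(δ ^ 2 * m / 4)) := by
    refine (real_le_card_nbrs p S U hSU (t := δ / 2) (by linarith) hM _).trans
      (Real.exp_le_exp.2 ?_)
    have : m ≤ M := hm.trans hM
    have h3 : δ ^ 2 * m ≤ δ ^ 2 * M := by gcongr
    nlinarith
  linarith

end RandomGraph

/-! ### Breadth-first exploration and the next layer -/

section Layers

variable {V : Type*} [Fintype V]

open Classical in
/-- The exploration of `G` from `w`: the vertices at distance less than `t`, and those at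
distance exactly `t`. -/
noncomputable def layers (G : SimpleGraph V) (w : V) : ℕ → Finset V × Finset V
  | 0 => (∅, {w})
  | t + 1 => ((layers G w t).1 ∪ (layers G w t).2,
      nbrs G (layers G w t).2 ((layers G w t).1 ∪ (layers G w t).2)ᶜ)

lemma edist_eq_add_one_iff {V : Type*} (G : SimpleGraph V) (w v : V) (t : ℕ) :
    G.edist w v = (t + 1 : ℕ) ↔
      ¬ G.edist w v < (t + 1 : ℕ) ∧ ∃ s, G.edist w s = t ∧ G.Adj s v := by
  constructor
  · intro h
    refine ⟨h ▸ lt_irrefl _, ?_⟩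
    obtain ⟨q, hq⟩ := G.exists_walk_of_edist_eq_coe h
    have hnil : ¬ q.Nil := by
      intro hn
      have := SimpleGraph.Walk.length_eq_zero_iff.2 hn
      omega
    have hadj := q.adj_penultimate hnil
    refine ⟨q.penultimate, le_antisymm ?_ ?_, hadj⟩
    · refine (SimpleGraph.edist_le q.dropLast).trans ?_
      simp [hq]
    · have h1 := G.edist_triangle (u := w) (v := q.penultimate) (w := v)
      rw [h, SimpleGraph.edist_eq_one_iff_adj.2 hadj, Nat.cast_add, Nat.cast_one] at h1
      exact (ENat.add_le_add_iff_right (by simp)).1 h1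
  · rintro ⟨h, s, hs, hadj⟩
    refine le_antisymm ?_ (not_lt.1 h)
    have h1 := G.edist_triangle (u := w) (v := s) (w := v)
    rwa [hs, SimpleGraph.edist_eq_one_iff_adj.2 hadj] at h1

lemma mem_layers (G : SimpleGraph V) (w v : V) (t : ℕ) :
    (v ∈ (layers G w t).1 ↔ G.edist w v < t) ∧ (v ∈ (layers G w t).2 ↔ G.edist w v = t) := by
  induction t generalizing v with
  | zero => simp [layers, eq_comm (a := v)]
  | succ t ih =>
    have h1 : ∀ v, v ∈ (layers G w (t + 1)).1 ↔ G.edist w v < (t + 1 : ℕ) := by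
      intro v
      simp only [layers, Finset.mem_union, ih v]
      rw [← le_iff_lt_or_eq, Nat.cast_add, Nat.cast_one, ENat.lt_natCast_add_one_iff]
    refine ⟨h1 v, ?_⟩
    rw [edist_eq_add_one_iff, ← h1]
    simp only [layers, nbrs, Finset.mem_filter, Finset.mem_compl, ih]

lemma coe_layers_snd (G : SimpleGraph V) (w : V) (t : ℕ) :
    ((layers G w t).2 : Set V) = shell G w t := by
  ext v
  exact (mem_layers G w v t).2

lemma ncard_shell (G : SimpleGraph V) (w : V) (t : ℕ) :
    (shell G w t).ncard = (layers G w t).2.card := by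
  rw [← coe_layers_snd, Set.ncard_coe_finset]

lemma disjoint_layers (G : SimpleGraph V) (w : V) (t : ℕ) :
    Disjoint (layers G w t).1 (layers G w t).2 := by
  rw [Finset.disjoint_left]
  intro v h1 h2
  rw [(mem_layers G w v t).1] at h1
  rw [(mem_layers G w v t).2] at h2
  exact h1.ne h2

/-- Growing the layers up to `t` only ever queries edges at vertices of earlier layers. This leaves
the edges out of layer `t` to unexplored vertices independent of the history. -/
lemma layers_congr {G G' : SimpleGraph V} {w : V} {t : ℕ}
    (h : ∀ e ∈ edgesBetween ((layers G w t).1 : Set V) Set.univ, e ∈ G.edgeSet ↔ e ∈ G'.edgeSet) :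
    layers G w t = layers G' w t := by
  induction t with
  | zero => rfl
  | succ t ih =>
    have hm : ∀ {S U : Set V}, S ⊆ (layers G w (t + 1)).1 →
        ∀ e ∈ edgesBetween S U, e ∈ G.edgeSet ↔ e ∈ G'.edgeSet := by
      rintro S U hS _ ⟨s, hs, u, hu, rfl⟩
      exact h _ ⟨s, hS hs, u, trivial, rfl⟩
    have h1 := ih (hm (by simp [layers]))
    simp only [layers] at hm ⊢
    rw [← h1, nbrs_congr (hm (by simp))]

lemma card_layers_one (G : SimpleGraph V) (w : V) : ((layers G w 1).2.card : ℝ) = deg G w := by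
  classical
  rw [deg, ← SimpleGraph.card_neighborFinset_eq_degree]
  congr 2
  ext v
  rw [(mem_layers G w v 1).2]
  simp

open Classical in
lemma card_nbrs_singleton (G : SimpleGraph V) (w : V) : ((nbrs G {w} {w}ᶜ).card : ℝ) = deg G w := by
  rw [← card_layers_one]
  simp [layers]

variable (p : unitInterval)

open Classical in
/-- A bound on the probability that the next layer misbehaves, given that it holds for
each possible value of the layers so far. -/
lemma real_layers_le (w : V) (t : ℕ) (R : Finset V → Finset V → Prop)
    (C : Finset V → Finset V → ℕ → Prop) (b : ℝ) (hb : 0 ≤ b)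
    (h : ∀ A S, R A S → (SimpleGraph.binomialRandom V p).real
      {G | C A S (nbrs G S (A ∪ S)ᶜ).card} ≤ b) :
    (SimpleGraph.binomialRandom V p).real {G | R (layers G w t).1 (layers G w t).2 ∧
      C (layers G w t).1 (layers G w t).2 (layers G w (t + 1)).2.card} ≤ b := by
  set μ := SimpleGraph.binomialRandom V p
  have hsub : {G | R (layers G w t).1 (layers G w t).2 ∧
      C (layers G w t).1 (layers G w t).2 (layers G w (t + 1)).2.card} ⊆
      ⋃ x ∈ (Finset.univ : Finset (Finset V × Finset V)), {G | layers G w t = x ∧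
        (R x.1 x.2 ∧ C x.1 x.2 (nbrs G x.2 (x.1 ∪ x.2)ᶜ).card)} := by
    intro G hG
    simp only [Set.mem_iUnion]
    exact ⟨layers G w t, Finset.mem_univ _, rfl, hG⟩
  have hterm : ∀ x : Finset V × Finset V, μ.real {G | layers G w t = x ∧
        (R x.1 x.2 ∧ C x.1 x.2 (nbrs G x.2 (x.1 ∪ x.2)ᶜ).card)} ≤
        μ.real ((fun G => layers G w t) ⁻¹' {x}) * b := by
    rintro ⟨A, S⟩
    by_cases hR : R A S
    swap
    · simp only [hR, false_and, and_false, Set.ofPred_false, measureReal_empty]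
      positivity
    by_cases hAS : Disjoint A S
    swap
    · have : {G | layers G w t = (A, S) ∧
        (R A S ∧ C A S (nbrs G S (A ∪ S)ᶜ).card)} = ∅ := by
        ext G
        simp only [Set.mem_ofPred_eq, Set.mem_empty_iff_false, iff_false]
        rintro ⟨h, -⟩
        have := disjoint_layers G w t
        rw [h] at this
        exact hAS this
      simp only [this, measureReal_empty]
      positivity
    -- The history uses edges touching `A`; the next layer uses edges from `S` to the complement of
    -- `A ∪ S`, and neither end of those lies in `A`.
    have hi := real_inter_of_disjoint_edges p (E := edgesBetween A Set.univ)
      (F := edgesBetween S ((A ∪ S)ᶜ : Finset V))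
      (disjoint_edgesBetween (Or.inl (Finset.disjoint_coe.2 hAS)) (Or.inl (Finset.disjoint_coe.2
        (disjoint_compl_right.mono_left Finset.subset_union_left))))
      (P := fun G => layers G w t = (A, S)) (Q := fun G => C A S (nbrs G S (A ∪ S)ᶜ).card)
      (by
        intro G G' hG
        refine propext ⟨fun h => ?_, fun h => ?_⟩
        · rw [← layers_congr (G := G) (G' := G'), h]
          simpa only [h] using hG
        · rw [← layers_congr (G := G') (G' := G), h]
          simpa only [h, iff_comm] using hG)
      (by
        intro G G' hG
        simp only [nbrs_congr hG])
    simp only [hR, true_and]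
    rw [hi]
    exact mul_le_mul_of_nonneg_left (h A S hR) measureReal_nonneg
  refine (measureReal_mono hsub (measure_ne_top _ _)).trans ((measureReal_biUnion_finset_le _ _).trans
    ((Finset.sum_le_sum fun x _ => hterm x).trans ?_))
  rw [← Finset.sum_mul, sum_measureReal_preimage_singleton _ (fun _ _ => .of_discrete)]
  simp

lemma one_sub_pow_le {x : ℝ} (hx0 : 0 ≤ x) (hx1 : x ≤ 1) (s : ℕ) (hs : x * s ≤ 1) :
    (1 - x) ^ s ≤ 1 - x * s * (1 - x * s) := by
  have h1 : (1 - x) ^ s ≤ Real.exp (-(x * s)) := by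
    have := pow_le_pow_left₀ (by linarith) (Real.one_sub_le_exp_neg x) s
    rw [← Real.exp_nat_mul] at this
    rwa [mul_neg, mul_comm] at this
  have h2 := (abs_le.1 (Real.abs_exp_sub_one_sub_id_le (x := -(x * s))
    (by rw [abs_neg, abs_of_nonneg (by positivity)]; exact hs))).2
  nlinarith

/-- Given the first layers, the next one is concentrated. -/
lemma real_next_layer_le (w : V) (t : ℕ) {d k K δ η : ℝ} (hd : d = Fintype.card V * p)
    (hd1 : 1 ≤ d) (hδ0 : 0 ≤ δ) (hδ1 : δ ≤ 1) (hη0 : 0 ≤ η) (hη : η ≤ 1 / 2)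
    (hη' : 2 * K * d ^ (t + 1) ≤ η * Fintype.card V) :
    (SimpleGraph.binomialRandom V p).real {G | ((layers G w (t + 1)).1.card ≤ K * d ^ t ∧
      k * d ^ t ≤ (layers G w t).2.card) ∧
      ¬ ((1 - (δ + η)) * (d * (layers G w t).2.card) ≤ (layers G w (t + 1)).2.card ∧
        ((layers G w (t + 1)).2.card : ℝ) ≤ (1 + (δ + η)) * (d * (layers G w t).2.card))} ≤
      2 * Real.exp (-(δ ^ 2 * (k * d ^ (t + 1)) / 8)) := by
  classical
  -- The first component at time `t + 1` is by definition `A ∪ S`, so its size is already part of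
  -- the history.
  refine real_layers_le p w t (fun A S => ((A ∪ S).card : ℝ) ≤ K * d ^ t ∧ k * d ^ t ≤ S.card)
    (fun A S m => ¬ ((1 - (δ + η)) * (d * S.card) ≤ m ∧ (m : ℝ) ≤ (1 + (δ + η)) * (d * S.card)))
    _ (by positivity) ?_
  rintro A S ⟨hK, hk'⟩
  set N : ℝ := (Fintype.card V : ℝ) with hN
  have hp0 : (0 : ℝ) ≤ p := p.2.1
  have hp1 : (p : ℝ) ≤ 1 := p.2.2
  have hN0 : 0 < N := by
    rcases (Nat.cast_nonneg (Fintype.card V) : (0 : ℝ) ≤ _).lt_or_eq with h | h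
    · exact h
    · rw [hN, ← h] at hd; linarith
  have hs0 : (0 : ℝ) ≤ S.card := by positivity
  have hS : (S.card : ℝ) ≤ K * d ^ t :=
    (Nat.cast_le.2 (Finset.card_le_card Finset.subset_union_right)).trans hK
  have hdt : K * d ^ t ≤ K * d ^ (t + 1) := by
    have : 0 ≤ K * d ^ t := hs0.trans hS
    rw [pow_succ]
    nlinarith
  have hx : ((A ∪ S).card : ℝ) ≤ η / 2 * N := by linarith
  have hy : (p : ℝ) * S.card ≤ η / 2 := by
    have : N * ((p : ℝ) * S.card) ≤ N * (η / 2) := by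
      calc N * (p * S.card) = d * S.card := by rw [hd]; ring
        _ ≤ d * (K * d ^ t) := by gcongr
        _ = K * d ^ (t + 1) := by ring
        _ ≤ _ := by linarith
    exact le_of_mul_le_mul_left this hN0
  have hU : (((A ∪ S)ᶜ : Finset V).card : ℝ) = N - (A ∪ S).card := by
    rw [Finset.card_compl, Nat.cast_sub (Finset.card_le_univ _)]
  have hpow := one_sub_pow_le hp0 hp1 S.card (by linarith)
  have hpow' := one_add_mul_le_pow (a := -(p : ℝ)) (by linarith) S.card
  rw [← sub_eq_add_neg] at hpow'
  have hq0 : 0 ≤ 1 - (1 - p : ℝ) ^ S.card := by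
    have := pow_le_one₀ (n := S.card) (sub_nonneg.2 hp1) (by linarith)
    linarith
  -- Depletion costs a factor 1 - η/2 for the explored vertices and another for vertices hit more
  -- than once; (1 - η/2)² ≥ 1 - η.
  have hm : (1 - η) * (d * S.card) ≤ ((A ∪ S)ᶜ : Finset V).card * (1 - (1 - p : ℝ) ^ S.card) := by
    rw [hU]
    have hps : 0 ≤ p * (S.card : ℝ) := by positivity
    calc (1 - η) * (d * S.card) = N * ((p * S.card) * (1 - η)) := by rw [hd]; ring
      _ ≤ N * ((p * S.card) * ((1 - η / 2) * (1 - η / 2))) := by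
        gcongr
        nlinarith
      _ = ((1 - η / 2) * N) * ((p * S.card) * (1 - η / 2)) := by ring
      _ ≤ (N - (A ∪ S).card) * ((p * S.card) * (1 - η / 2)) := by
        have : 0 ≤ ((p : ℝ) * S.card) * (1 - η / 2) := mul_nonneg hps (by linarith)
        gcongr
        linarith
      _ ≤ (N - (A ∪ S).card) * (1 - (1 - p : ℝ) ^ S.card) := by
        have h1 : ((p : ℝ) * S.card) * (1 - η / 2) ≤ (p * S.card) * (1 - p * S.card) := by gcongr
        have h2 : 0 ≤ N - (A ∪ S).card := by nlinarith
        gcongr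
        linarith
  have hM : ((A ∪ S)ᶜ : Finset V).card * (1 - (1 - p : ℝ) ^ S.card) ≤ d * S.card := by
    rw [hU]
    calc (N - (A ∪ S).card) * (1 - (1 - p : ℝ) ^ S.card) ≤ N * (p * S.card) := by
          gcongr
          · linarith [(Nat.cast_nonneg (A ∪ S).card : (0 : ℝ) ≤ _)]
          · linarith
      _ = _ := by rw [hd]; ring
  have hdS : 0 ≤ d * S.card := by positivity
  refine (measureReal_mono ?_).trans ((real_card_nbrs_deviation p S (A ∪ S)ᶜ ?_ hδ0 hδ1
    (mul_nonneg (by linarith) hdS) hm hM).trans ?_)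
  · intro G hG hG'
    refine hG ⟨le_trans ?_ hG'.1, le_trans hG'.2 ?_⟩
    · nlinarith [mul_nonneg (mul_nonneg hδ0 hη0) hdS]
    · gcongr
      linarith
  · exact disjoint_compl_right.mono_left Finset.subset_union_right
  · refine mul_le_mul_of_nonneg_left (Real.exp_le_exp.2 (neg_le_neg ?_)) (by norm_num)
    have : k * d ^ (t + 1) ≤ d * S.card := by
      calc k * d ^ (t + 1) = d * (k * d ^ t) := by ring
        _ ≤ _ := by gcongr
    have h3 : k * d ^ (t + 1) / 2 ≤ (1 - η) * (d * S.card) := by nlinarith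
    have h4 := mul_le_mul_of_nonneg_left h3 (sq_nonneg δ)
    linarith

end Layers

/-! ### Deterministic accumulation of errors -/

/-- A sequence that is multiplied by `d` up to relative errors `θ t` grows like `d ^ t`. -/
lemma growth {s b θ : ℕ → ℝ} {d α β : ℝ} {T : ℕ} (hd : 2 ≤ d) (hα : 0 ≤ α) (hβ : 1 ≤ β)
    (h1 : α * d ≤ s 1) (h1' : s 1 ≤ β * d) (hb1 : b 1 = 1) (hb : ∀ t, b (t + 1) = b t + s t)
    (hθ : ∀ t, 0 ≤ θ t) (hΘ : ∀ t ≤ T, ∑ i ∈ Finset.Ico 1 t, θ i ≤ 1 / 2)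
    (hstep : ∀ t, 1 ≤ t → t < T → b (t + 1) ≤ 4 * β * d ^ t → α / 2 * d ^ t ≤ s t →
      (1 - θ t) * (d * s t) ≤ s (t + 1) ∧ s (t + 1) ≤ (1 + θ t) * (d * s t))
    (t : ℕ) (ht1 : 1 ≤ t) (htT : t ≤ T) :
    (1 - ∑ i ∈ Finset.Ico 1 t, θ i) * (d ^ (t - 1) * s 1) ≤ s t ∧
      s t ≤ (1 + 2 * ∑ i ∈ Finset.Ico 1 t, θ i) * (d ^ (t - 1) * s 1) ∧
      b t ≤ 4 * β * d ^ (t - 1) := by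
  induction t, ht1 using Nat.le_induction with
  | base => simp only [Finset.Ico_self, Finset.sum_empty]; norm_num; linarith
  | succ t ht ih =>
    obtain ⟨hl, hu, hbt⟩ := ih (by omega)
    have hΘt := hΘ t (by omega)
    have hΘs := hΘ (t + 1) htT
    rw [Finset.sum_Ico_succ_top ht] at hΘs ⊢
    set Θ := ∑ i ∈ Finset.Ico 1 t, θ i
    have hΘ0 : 0 ≤ Θ := Finset.sum_nonneg fun i _ => hθ i
    have hd0 : 0 < d := by linarith
    have hs1 : 0 ≤ s 1 := (mul_nonneg hα hd0.le).trans h1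
    obtain ⟨j, rfl⟩ : ∃ j, t = j + 1 := ⟨t - 1, by omega⟩
    simp only [Nat.add_sub_cancel] at *
    have hdj : 0 < d ^ j := by positivity
    set X := d ^ j * s 1 with hX
    have hX0 : 0 ≤ X := by positivity
    have hXα : α * d ^ (j + 1) ≤ X := by
      calc α * d ^ (j + 1) = d ^ j * (α * d) := by ring
        _ ≤ _ := mul_le_mul_of_nonneg_left h1 hdj.le
    have hXβ : X ≤ β * d ^ (j + 1) := by
      calc X ≤ d ^ j * (β * d) := mul_le_mul_of_nonneg_left h1' hdj.le
        _ = _ := by ring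
    have hdX : d ^ (j + 1) * s 1 = d * X := by rw [hX]; ring
    -- As d ≥ 2, the old bound 4βd^j is at most 2βd^(j+1), and the current layer adds at most
    -- 2βd^(j+1).
    have hbt' : b (j + 1 + 1) ≤ 4 * β * d ^ (j + 1) := by
      rw [hb]
      have : 2 * d ^ j ≤ d ^ (j + 1) := by rw [pow_succ]; nlinarith
      have h2 : s (j + 1) ≤ 2 * X := hu.trans (by nlinarith)
      nlinarith
    have hθt := hθ (j + 1)
    obtain ⟨g1, g2⟩ := hstep (j + 1) ht (by omega) hbt' (by nlinarith)
    rw [hdX]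
    have hdX0 : 0 ≤ d * X := by positivity
    refine ⟨le_trans ?_ g1, g2.trans ?_, hbt'⟩
    · calc (1 - (Θ + θ (j + 1))) * (d * X) ≤ ((1 - θ (j + 1)) * (1 - Θ)) * (d * X) := by
            gcongr
            nlinarith
        _ = (1 - θ (j + 1)) * (d * ((1 - Θ) * X)) := by ring
        _ ≤ _ := by
            have : 0 ≤ 1 - θ (j + 1) := by linarith
            gcongr
    · calc (1 + θ (j + 1)) * (d * s (j + 1)) ≤ (1 + θ (j + 1)) * (d * ((1 + 2 * Θ) * X)) := by
            gcongr
        _ = ((1 + θ (j + 1)) * (1 + 2 * Θ)) * (d * X) := by ring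
        -- The factor 2 in front of the sum absorbs the cross term 2θΘ ≤ θ, as Θ ≤ 1/2.
        _ ≤ _ := by
            gcongr
            nlinarith

lemma sum_geometric_le (t : ℕ) : ∑ i ∈ Finset.Ico 1 t, ((1 : ℝ) / 2) ^ i ≤ 1 := by
  rcases Nat.eq_zero_or_pos t with rfl | ht
  · simp
  have : ∑ i ∈ Finset.Ico 1 t, ((1 : ℝ) / 2) ^ i = 1 - 2 * (1 / 2) ^ t := by
    induction t, ht using Nat.le_induction with
    | base => norm_num
    | succ t ht ih => rw [Finset.sum_Ico_succ_top ht, ih, pow_succ]; ring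
  rw [this]
  have : (0 : ℝ) < (1 / 2) ^ t := by positivity
  linarith

lemma sum_geometric_sub_le {t T : ℕ} (h : t ≤ T) :
    ∑ i ∈ Finset.Ico 1 t, ((1 : ℝ) / 2) ^ (T - i) ≤ 1 := by
  -- The sharper bound makes the induction close: the new term equals the old bound and doubles it.
  have h1 : ∑ i ∈ Finset.Ico 1 t, ((1 : ℝ) / 2) ^ (T - i) ≤ (1 / 2) ^ (T - t) := by
    rcases Nat.eq_zero_or_pos t with rfl | ht
    · simp
    induction t, ht using Nat.le_induction with
    | base => simp
    | succ t ht ih =>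
      rw [Finset.sum_Ico_succ_top ht]
      have := ih (by omega)
      rw [show T - t = (T - (t + 1)) + 1 by omega, pow_succ] at this ⊢
      linarith
  exact h1.trans (pow_le_one₀ (by norm_num) (by norm_num))

/-- The conditions of `Expands` follow from the growth of the layers step by step. -/
lemma expands_of_step {V : Type*} [Fintype V] {G : SimpleGraph V} {d α β ε : ℝ} {T : ℕ}
    (hd : 2 ≤ d) (hα : 0 < α) (hα1 : α ≤ 1) (hβ : 1 ≤ β) (hε : 0 < ε) (hε' : ε ≤ 1 / 4)
    (hdeg : ∀ w, (1 - ε) * (α * d) ≤ deg G w ∧ deg G w ≤ (1 + ε) * (β * d))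
    (hstep : ∀ w, ∀ t ∈ Finset.Ico 1 T, (layers G w (t + 1)).1.card ≤ 8 * β * d ^ t →
      α / 4 * d ^ t ≤ (layers G w t).2.card →
      (1 - (ε * (1 / 2) ^ t + ε * (1 / 2) ^ (T - t))) * (d * (layers G w t).2.card) ≤
        (layers G w (t + 1)).2.card ∧
      ((layers G w (t + 1)).2.card : ℝ) ≤
        (1 + (ε * (1 / 2) ^ t + ε * (1 / 2) ^ (T - t))) * (d * (layers G w t).2.card)) :
    Expands G d T α β (8 * ε) := by
  classical
  intro w
  have hd0 : 0 < d := by linarith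
  obtain ⟨hl, hu⟩ := hdeg w
  have hαd : 0 < α * d := by positivity
  have hβd : 0 < β * d := by positivity
  have hΘ : ∀ t ≤ T, ∑ i ∈ Finset.Ico 1 t, (ε * (1 / 2) ^ i + ε * (1 / 2) ^ (T - i)) ≤ 2 * ε := by
    intro t ht
    rw [Finset.sum_add_distrib, ← Finset.mul_sum, ← Finset.mul_sum]
    nlinarith [sum_geometric_le t, sum_geometric_sub_le ht]
  have hdeg0 : 0 ≤ deg G w := le_trans (by nlinarith) hl
  -- Passing to α/2 and 2β absorbs the 1 ± ε in the degree bounds.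
  have hg := growth (s := fun t => ((layers G w t).2.card : ℝ))
    (b := fun t => ((layers G w t).1.card : ℝ))
    (θ := fun t => ε * (1 / 2) ^ t + ε * (1 / 2) ^ (T - t)) (T := T) (α := α / 2) (β := 2 * β)
    hd (by positivity) (by linarith) (by rw [card_layers_one]; nlinarith)
    (by rw [card_layers_one]; nlinarith) (by simp [layers])
    (fun t => by
      simp only [layers]
      rw [← Nat.cast_add, ← Finset.card_union_of_disjoint (disjoint_layers G w t)])
    (fun t => by positivity) (fun t ht => (hΘ t ht).trans (by linarith))
    (fun t h1 h2 h3 h4 => hstep w t (Finset.mem_Ico.2 ⟨h1, h2⟩) (by linarith) (by linarith))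
  have key : ∀ t, 1 ≤ t → t ≤ T →
      (1 - 2 * ε) * (d ^ (t - 1) * deg G w) ≤ ((shell G w t).ncard : ℝ) ∧
      ((shell G w t).ncard : ℝ) ≤ (1 + 4 * ε) * (d ^ (t - 1) * deg G w) := by
    intro t h1 h2
    obtain ⟨g1, g2, -⟩ := hg t h1 h2
    simp only [card_layers_one] at g1 g2
    rw [ncard_shell]
    have := hΘ t h2
    have h0 : 0 ≤ d ^ (t - 1) * deg G w := by positivity
    exact ⟨le_trans (by gcongr) g1,
      g2.trans (mul_le_mul_of_nonneg_right (by linarith) h0)⟩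
  refine ⟨⟨by nlinarith, by nlinarith⟩, fun t h1 h2 => ?_, fun t h2 => ?_⟩
  · obtain ⟨g1, g2⟩ := key t h1 h2
    have h0 : 0 ≤ d ^ (t - 1) * deg G w := by positivity
    exact ⟨by nlinarith, by nlinarith⟩
  · rcases Nat.eq_zero_or_pos t with rfl | h1
    · rw [ncard_shell]
      simp only [layers, Finset.card_singleton, pow_zero]
      push_cast
      constructor <;> nlinarith
    obtain ⟨g1, g2⟩ := key t h1 h2
    have hp : d ^ t = d ^ (t - 1) * d := by rw [← pow_succ, Nat.sub_add_cancel h1]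
    have hX : 0 < d ^ (t - 1) := by positivity
    constructor
    · refine le_trans ?_ g1
      calc (1 - 8 * ε) * (α * d ^ t) ≤ ((1 - 2 * ε) * (1 - ε)) * (α * d ^ t) := by
            gcongr
            nlinarith
        _ = (1 - 2 * ε) * (d ^ (t - 1) * ((1 - ε) * (α * d))) := by rw [hp]; ring
        _ ≤ _ := by
            have : 0 ≤ 1 - 2 * ε := by linarith
            gcongr
    · refine g2.trans ?_
      calc (1 + 4 * ε) * (d ^ (t - 1) * deg G w)
          ≤ (1 + 4 * ε) * (d ^ (t - 1) * ((1 + ε) * (β * d))) := by gcongr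
        _ = ((1 + 4 * ε) * (1 + ε)) * (β * d ^ t) := by rw [hp]; ring
        _ ≤ _ := by
            gcongr
            nlinarith

lemma Expands.mono {V : Type*} [Fintype V] {G : SimpleGraph V} {d α β ε ε' : ℝ} {T : ℕ}
    (hd : 0 ≤ d) (hα : 0 ≤ α) (hβ : 0 ≤ β) (hε : ε ≤ ε') (h : Expands G d T α β ε) :
    Expands G d T α β ε' := by
  have hlow : ∀ {x y : ℝ}, 0 ≤ x → (1 - ε) * x ≤ y → (1 - ε') * x ≤ y := fun hx h => by nlinarith
  have hupp : ∀ {x y : ℝ}, 0 ≤ x → y ≤ (1 + ε) * x → y ≤ (1 + ε') * x := fun hx h => by nlinarith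
  intro w
  obtain ⟨h1, h2, h3⟩ := h w
  have hdeg : 0 ≤ deg G w := by unfold deg; positivity
  refine ⟨h1.imp (hlow (by positivity)) (hupp (by positivity)), fun t a b => ?_, fun t a => ?_⟩
  · exact (h2 t a b).imp (hlow (by positivity)) (hupp (by positivity))
  · exact (h3 t a).imp (hlow (by positivity)) (hupp (by positivity))

/-! ### Union bound and degree tails -/

section Union

variable {V : Type*} [Fintype V] (p : unitInterval)

/-- The union bound over all vertices and all steps. -/
lemma real_not_expands_le {d α β ε D : ℝ} {T : ℕ} (hd : d = Fintype.card V * p) (hd4 : 4 ≤ d)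
    (hα : 0 < α) (hα1 : α ≤ 1) (hβ : 1 ≤ β) (hε : 0 < ε) (hε' : ε ≤ 1 / 4)
    (hT : 32 * β * d ^ T ≤ ε * Fintype.card V)
    (hdeg : ∀ w : V, (SimpleGraph.binomialRandom V p).real {G | ¬ ((1 - ε) * (α * d) ≤ deg G w ∧
      deg G w ≤ (1 + ε) * (β * d))} ≤ D) :
    (SimpleGraph.binomialRandom V p).real {G | ¬ Expands G d T α β (8 * ε)} ≤
      Fintype.card V * D +
      Fintype.card V * (T * (2 * Real.exp (-(ε ^ 2 * α * d ^ 2 / 128)))) := by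
  set μ := SimpleGraph.binomialRandom V p
  set B : V → ℕ → Set (SimpleGraph V) := fun w t =>
    {G | ((layers G w (t + 1)).1.card ≤ 8 * β * d ^ t ∧
      α / 4 * d ^ t ≤ (layers G w t).2.card) ∧
      ¬ ((1 - (ε * (1 / 2) ^ t + ε * (1 / 2) ^ (T - t))) * (d * (layers G w t).2.card) ≤
        (layers G w (t + 1)).2.card ∧
      ((layers G w (t + 1)).2.card : ℝ) ≤
        (1 + (ε * (1 / 2) ^ t + ε * (1 / 2) ^ (T - t))) * (d * (layers G w t).2.card))}
  have hsub : {G | ¬ Expands G d T α β (8 * ε)} ⊆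
      (⋃ w ∈ (Finset.univ : Finset V), {G | ¬ ((1 - ε) * (α * d) ≤ deg G w ∧
        deg G w ≤ (1 + ε) * (β * d))}) ∪
      ⋃ w ∈ (Finset.univ : Finset V), ⋃ t ∈ Finset.Ico 1 T, B w t := by
    intro G hG
    by_contra hcon
    simp only [Set.mem_union, Set.mem_iUnion, not_or, not_exists, Finset.mem_univ,
      forall_true_left] at hcon
    obtain ⟨h1, h2⟩ := hcon
    refine hG (expands_of_step (by linarith) hα hα1 hβ hε hε' (fun w => not_not.1 (h1 w))
      fun w t ht a b => ?_)
    by_contra hc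
    exact h2 w t ht ⟨⟨a, b⟩, hc⟩
  have hB : ∀ w, ∀ t ∈ Finset.Ico 1 T,
      μ.real (B w t) ≤ 2 * Real.exp (-(ε ^ 2 * α * d ^ 2 / 128)) := by
    intro w t ht
    rw [Finset.mem_Ico] at ht
    have hd0 : 0 < d := by linarith
    have hh : ∀ j, (1 / 2 : ℝ) ^ j ≤ 1 := fun j => pow_le_one₀ (by norm_num) (by norm_num)
    have hh0 : ∀ j, 0 ≤ (1 / 2 : ℝ) ^ j := fun j => by positivity
    refine (real_next_layer_le p w t (d := d) (k := α / 4) (K := 8 * β) (δ := ε * (1 / 2) ^ t)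
      (η := ε * (1 / 2) ^ (T - t)) hd (by linarith) (by positivity)
      (by nlinarith [hh t, hh0 t]) (by positivity) (by nlinarith [hh (T - t), hh0 (T - t)])
      ?_).trans ?_
    · obtain ⟨j, rfl⟩ : ∃ j, T = t + 1 + j := ⟨T - (t + 1), by omega⟩
      have e : t + 1 + j - t = j + 1 := by omega
      rw [e]
      have h2 : (2 : ℝ) ^ j ≤ d ^ j := pow_le_pow_left₀ (by norm_num) (by linarith) j
      have h3 : (2 : ℝ) ^ j * (1 / 2) ^ j = 1 := by rw [← mul_pow]; norm_num
      calc 2 * (8 * β) * d ^ (t + 1)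
          = (16 * β * d ^ (t + 1)) * (2 ^ j * (1 / 2) ^ j) := by rw [h3]; ring
        _ ≤ (16 * β * d ^ (t + 1)) * (d ^ j * (1 / 2) ^ j) := by gcongr
        _ = (32 * β * d ^ (t + 1 + j)) * (1 / 2) ^ (j + 1) := by ring
        _ ≤ (ε * Fintype.card V) * (1 / 2) ^ (j + 1) := by gcongr
        _ = _ := by ring
    · refine mul_le_mul_of_nonneg_left (Real.exp_le_exp.2 (neg_le_neg ?_)) (by norm_num)
      -- Halving the random error at each step costs 4^t against d^t; as d ≥ 4, the worst case is t
      -- = 1, with exponent of order d².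
      have h4 : d / 4 ≤ (d / 4) ^ t := le_self_pow₀ (by linarith) (by omega)
      have h5 : ((1 / 2 : ℝ) ^ t) ^ 2 * d ^ t = (d / 4) ^ t := by
        rw [← pow_mul, mul_comm t 2, pow_mul, ← mul_pow]
        congr 1
        ring
      calc ε ^ 2 * α * d ^ 2 / 128 = ε ^ 2 * α * d / 32 * (d / 4) := by ring
        _ ≤ ε ^ 2 * α * d / 32 * (d / 4) ^ t := by gcongr
        _ = _ := by rw [← h5]; ring
  refine (measureReal_mono hsub (measure_ne_top _ _)).trans
    ((measureReal_union_le _ _).trans (add_le_add ?_ ?_))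
  · refine (measureReal_biUnion_finset_le _ _).trans
      ((Finset.sum_le_sum fun w _ => hdeg w).trans ?_)
    simp
  · refine (measureReal_biUnion_finset_le _ _).trans
      ((Finset.sum_le_sum (g := fun _ => T * (2 * Real.exp (-(ε ^ 2 * α * d ^ 2 / 128))))
        fun w _ => ?_).trans ?_)
    · refine (measureReal_biUnion_finset_le _ _).trans
        ((Finset.sum_le_sum fun t ht => hB w t ht).trans ?_)
      rw [Finset.sum_const, Nat.card_Ico, nsmul_eq_mul]
      gcongr
      omega
    · simp

/-- The `+ 1` pays for the n - 1 possible neighbours: the mean is d - p, not d. -/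
lemma real_deg_le (w : V) {d t : ℝ} (hd : d = Fintype.card V * p) (ht : 0 ≤ t) (a : ℝ) :
    (SimpleGraph.binomialRandom V p).real {G | deg G w ≤ a} ≤
      Real.exp (t * a - d * (1 - Real.exp (-t)) + 1) := by
  classical
  have h := real_card_nbrs_le p {w} {w}ᶜ disjoint_compl_right ht (m := d - p) (by
    rw [Finset.card_compl, Nat.cast_sub (Finset.card_le_univ _), hd]
    simp only [Finset.card_singleton]
    push_cast
    linarith) a
  simp only [card_nbrs_singleton] at h
  refine h.trans (Real.exp_le_exp.2 ?_)
  have h1 : Real.exp (-t) ≤ 1 := Real.exp_le_one_iff.2 (by linarith)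
  have h2 := Real.exp_pos (-t)
  have hp0 : (0 : ℝ) ≤ p := p.2.1
  have hp1 : (p : ℝ) ≤ 1 := p.2.2
  nlinarith

lemma real_le_deg (w : V) {d t : ℝ} (hd : d = Fintype.card V * p) (ht : 0 ≤ t) (a : ℝ) :
    (SimpleGraph.binomialRandom V p).real {G | a ≤ deg G w} ≤
      Real.exp (-t * a + d * (Real.exp t - 1)) := by
  classical
  have h := real_le_card_nbrs p {w} {w}ᶜ disjoint_compl_right ht (m := d) (by
    rw [Finset.card_compl, Nat.cast_sub (Finset.card_le_univ _), hd]
    simp only [Finset.card_singleton]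
    push_cast
    have hp0 : (0 : ℝ) ≤ p := p.2.1
    linarith) a
  simpa only [card_nbrs_singleton] using h

end Union

/-! ### Passage to the limit -/

lemma tendsto_log_natCast : Tendsto (fun n : ℕ => Real.log n) atTop atTop :=
  Real.tendsto_log_atTop.comp tendsto_natCast_atTop_atTop

lemma eq_card_mul {d : ℝ} {n : ℕ} {p : unitInterval} (hp : (p : ℝ) = d / n) (hn : 0 < n) :
    d = Fintype.card (Fin n) * p := by
  have : (n : ℝ) ≠ 0 := by positivity
  rw [hp, Fintype.card_fin]
  field_simp

lemma whp_of_tendsto {p : ℕ → unitInterval} {E : (n : ℕ) → SimpleGraph (Fin n) → Prop}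
    (h : Tendsto (fun n => (SimpleGraph.binomialRandom (Fin n) (p n)).real {G | ¬ E n G})
      atTop (𝓝 0)) : WHP p E := by
  have h1 : Tendsto (fun n => (SimpleGraph.binomialRandom (Fin n) (p n)).real {G | E n G})
      atTop (𝓝 1) := by
    have := h.const_sub 1
    rw [sub_zero] at this
    refine this.congr fun n => ?_
    rw [← probReal_compl_eq_one_sub .of_discrete]
    congr 1
    ext G
    simp
  have h2 := ENNReal.tendsto_ofReal h1
  rw [ENNReal.ofReal_one] at h2
  exact h2.congr fun n => ofReal_measureReal

/-- Degree concentration with polynomially small error implies that the shells grow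
geometrically with high probability. -/
lemma whp_expands {d : ℕ → ℝ} {p : ℕ → unitInterval} {T : ℕ → ℕ} {α β : ℝ}
    (hp : ∀ n : ℕ, (p n : ℝ) = d n / (n : ℝ))
    (hd : ∀ᶠ n : ℕ in atTop, Real.log (n : ℝ) ≤ d n)
    (hT : (fun n : ℕ => d n ^ T n) =o[atTop] (fun n : ℕ => (n : ℝ)))
    (hα : 0 < α) (hα1 : α ≤ 1) (hβ : 1 ≤ β)
    (hdeg : ∀ ε : ℝ, 0 < ε → ε ≤ 1 → ∃ γ > 0, ∀ᶠ n : ℕ in atTop, ∀ w : Fin n,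
      (SimpleGraph.binomialRandom (Fin n) (p n)).real {G | ¬ ((1 - ε) * (α * d n) ≤ deg G w ∧
        deg G w ≤ (1 + ε) * (β * d n))} ≤ 6 * Real.exp (-((1 + γ) * Real.log n)))
    (ε : ℝ) (hε : 0 < ε) : WHP p (fun n G => Expands G (d n) (T n) α β ε) := by
  apply whp_of_tendsto
  obtain ⟨ε', hε'0, hε'1, hε'⟩ : ∃ ε' : ℝ, 0 < ε' ∧ ε' ≤ 1 / 4 ∧ 8 * ε' ≤ ε :=
    ⟨min (1 / 4) (ε / 8), by positivity, min_le_left _ _, by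
      linarith [min_le_right (1 / 4) (ε / 8)]⟩
  obtain ⟨γ, hγ, hdeg'⟩ := hdeg ε' hε'0 (by linarith)
  have hlim : Tendsto (fun n : ℕ => 6 * Real.exp (-(γ * Real.log n)) +
      2 * Real.exp (-Real.log n)) atTop (𝓝 0) := by
    have h1 : Tendsto (fun n : ℕ => Real.exp (-(γ * Real.log n))) atTop (𝓝 0) :=
      Real.tendsto_exp_neg_atTop_nhds_zero.comp (tendsto_log_natCast.const_mul_atTop hγ)
    have h2 : Tendsto (fun n : ℕ => Real.exp (-Real.log n)) atTop (𝓝 0) :=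
      Real.tendsto_exp_neg_atTop_nhds_zero.comp tendsto_log_natCast
    simpa using (h1.const_mul 6).add (h2.const_mul 2)
  refine squeeze_zero' (.of_forall fun n => measureReal_nonneg) ?_ hlim
  have hT1 := hT.bound (c := ε' / (32 * β)) (by positivity)
  have hT2 := hT.bound (c := 1) one_pos
  filter_upwards [hd, hdeg', hT1, hT2, eventually_gt_atTop 0,
    tendsto_log_natCast.eventually_ge_atTop 4,
    tendsto_log_natCast.eventually_ge_atTop (384 / (ε' ^ 2 * α))] with n h1 h2 h3 h4 hn h5 h6
  have hn' : (0 : ℝ) < n := by positivity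
  have hd4 : 4 ≤ d n := h5.trans h1
  have hdT : 0 < d n ^ T n := by positivity
  rw [Real.norm_of_nonneg hdT.le, Real.norm_of_nonneg hn'.le] at h3 h4
  -- T ≤ 2^T ≤ d^T ≤ n, so the union bound has at most n² terms, each at most 2n^{-3} by `h7`.
  have hTn : (T n : ℝ) ≤ n := by
    have a1 : (T n : ℝ) ≤ 2 ^ T n := by exact_mod_cast (Nat.lt_two_pow_self (n := T n)).le
    have a2 : (2 : ℝ) ^ T n ≤ d n ^ T n := pow_le_pow_left₀ (by norm_num) (by linarith) _
    linarith
  have hexp : Real.exp (Real.log n) = n := Real.exp_log hn'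
  have hmono : {G : SimpleGraph (Fin n) | ¬ Expands G (d n) (T n) α β ε} ⊆
      {G | ¬ Expands G (d n) (T n) α β (8 * ε')} := fun G hG hG' =>
    hG (hG'.mono (by linarith) hα.le (by linarith) hε')
  refine (measureReal_mono hmono).trans ((real_not_expands_le (p n) (eq_card_mul (hp n) hn) hd4 hα
    hα1 hβ hε'0 hε'1 ?_ h2).trans (add_le_add ?_ ?_))
  · rw [Fintype.card_fin]
    calc 32 * β * d n ^ T n ≤ 32 * β * (ε' / (32 * β) * n) := by gcongr
      _ = ε' * n := by field_simp
  · rw [Fintype.card_fin]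
    apply le_of_eq
    calc (n : ℝ) * (6 * Real.exp (-((1 + γ) * Real.log n)))
        = 6 * (Real.exp (Real.log n) * Real.exp (-((1 + γ) * Real.log n))) := by rw [hexp]; ring
      _ = _ := by rw [← Real.exp_add]; congr 2; ring
  · rw [Fintype.card_fin]
    have h7 : 3 * Real.log n ≤ ε' ^ 2 * α * d n ^ 2 / 128 := by
      rw [div_le_iff₀ (by positivity)] at h6
      have h8 : 384 ≤ d n * (ε' ^ 2 * α) := h6.trans (by gcongr)
      nlinarith
    calc (n : ℝ) * (T n * (2 * Real.exp (-(ε' ^ 2 * α * d n ^ 2 / 128))))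
        ≤ n * (n * (2 * Real.exp (-(3 * Real.log n)))) := by gcongr
      _ = 2 * (Real.exp (Real.log n) * Real.exp (Real.log n) * Real.exp (-(3 * Real.log n))) := by
          rw [hexp]; ring
      _ = _ := by rw [← Real.exp_add, ← Real.exp_add]; congr 2; ring

/-- A union bound for the two tails of the degree. -/
lemma real_not_deg_le {V : Type*} [Fintype V] (p : unitInterval) (w : V) {d a b t u x : ℝ}
    (hd : d = Fintype.card V * p) (ht : 0 ≤ t) (hu : 0 ≤ u)
    (hx : t * a - d * (1 - Real.exp (-t)) ≤ -x) (hx' : -u * b + d * (Real.exp u - 1) ≤ -x) :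
    (SimpleGraph.binomialRandom V p).real {G | ¬ (a ≤ deg G w ∧ deg G w ≤ b)} ≤
      6 * Real.exp (-x) := by
  have hsub : {G : SimpleGraph V | ¬ (a ≤ deg G w ∧ deg G w ≤ b)} ⊆
      {G | deg G w ≤ a} ∪ {G | b ≤ deg G w} := by
    intro G hG
    simp only [Set.mem_ofPred_eq, not_and_or, not_le] at hG
    exact hG.imp le_of_lt le_of_lt
  have h1 : Real.exp (t * a - d * (1 - Real.exp (-t)) + 1) ≤ Real.exp 1 * Real.exp (-x) := by
    rw [← Real.exp_add]
    exact Real.exp_le_exp.2 (by linarith)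
  have h2 := Real.exp_le_exp.2 hx'
  have h3 := real_deg_le p w hd ht a
  have h4 := real_le_deg p w hd hu b
  have h5 := (measureReal_mono (μ := SimpleGraph.binomialRandom V p) hsub).trans
    (measureReal_union_le _ _)
  have h6 := Real.exp_one_lt_d9
  nlinarith [Real.exp_pos (-x)]

end ShellGrowth

/-! ### Choice of constants and the main theorem -/

open ShellGrowth in
theorem mainTheorem3 (c : ℝ) (hc : 1 < c) :
    ∃ α β : ℝ, 0 < α ∧ α < 1 ∧ 1 < β ∧
      ∀ (d : ℕ → ℝ) (p : ℕ → unitInterval) (T : ℕ → ℕ),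
        (∀ n : ℕ, (p n : ℝ) = d n / (n : ℝ)) →
        (∀ᶠ n : ℕ in atTop, c * Real.log (n : ℝ) ≤ d n) →
        ((fun n : ℕ => d n ^ T n) =o[atTop] (fun n : ℕ => (n : ℝ))) →
        (∀ ε : ℝ, 0 < ε →
          ShellGrowth.WHP p (fun n G => ShellGrowth.Expands G (d n) (T n) α β ε)) ∧
        (((fun n : ℕ => Real.log (n : ℝ)) =o[atTop] d) →
          ∀ ε : ℝ, 0 < ε →
            ShellGrowth.WHP p (fun n G => ShellGrowth.Expands G (d n) (T n) 1 1 ε)) := by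
  -- The lower-tail exponent is tαd - (1 - e^{-t})d. Making e^{-t} and tα at most κ/4 leaves -(1 -
  -- κ/2)d, and (1 - κ/2)c = 1 + (c-1)/2 exceeds 1.
  set κ : ℝ := 1 - 1 / c with hκ
  have hcκ : c * κ = c - 1 := by rw [hκ]; field_simp
  have hκ0 : 0 < κ := by
    rw [hκ, sub_pos, div_lt_one (by linarith)]
    exact hc
  have hκ1 : κ < 1 := by
    rw [hκ]
    linarith [show 0 < 1 / c by positivity]
  set t : ℝ := -Real.log (κ / 4) with ht
  have hexpt : Real.exp (-t) = κ / 4 := by rw [ht, neg_neg, Real.exp_log (by positivity)]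
  have ht0 : 0 < t := by
    rw [ht, neg_pos]
    exact Real.log_neg (by positivity) (by linarith)
  obtain ⟨α, hα0, hα1, hαt⟩ : ∃ α : ℝ, 0 < α ∧ α < 1 ∧ t * α ≤ κ / 4 := by
    refine ⟨min (1 / 2) (κ / (4 * t)), by positivity,
      (min_le_left _ _).trans_lt (by norm_num), ?_⟩
    calc t * min (1 / 2) (κ / (4 * t)) ≤ t * (κ / (4 * t)) := by gcongr; exact min_le_right _ _
      _ = κ / 4 := by field_simp
  refine ⟨α, 4, hα0, hα1, by norm_num, fun d p T hp hd hT => ?_⟩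
  have hlog : ∀ᶠ n : ℕ in atTop, 0 ≤ Real.log n := tendsto_log_natCast.eventually_ge_atTop 0
  have hd1 : ∀ᶠ n : ℕ in atTop, Real.log (n : ℝ) ≤ d n := by
    filter_upwards [hd, hlog] with n h1 h2
    nlinarith
  refine ⟨whp_expands hp hd1 hT hα0 hα1.le (by norm_num) fun ε hε hε1 => ?_,
    fun hω => whp_expands hp hd1 hT one_pos le_rfl le_rfl fun ε hε hε1 => ?_⟩
  -- The lower tail allows γ = (c-1)/2. The cap at 1 serves the upper tail, where β = 4 and u = 1
  -- give an exponent at most (e - 5)d ≤ -2d.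
  · refine ⟨min 1 ((c - 1) / 2), lt_min one_pos (by linarith), ?_⟩
    filter_upwards [hd, hd1, hlog, eventually_gt_atTop 0] with n h1 h2 h3 hn w
    have hd0 : 0 ≤ d n := h3.trans h2
    refine real_not_deg_le (p n) w (t := t) (u := 1) (eq_card_mul (hp n) hn) ht0.le zero_le_one
      ?_ ?_
    · rw [hexpt]
      have g1 : t * ((1 - ε) * (α * d n)) ≤ κ / 4 * d n := by
        calc t * ((1 - ε) * (α * d n)) = (1 - ε) * ((t * α) * d n) := by ring
          _ ≤ 1 * ((κ / 4) * d n) := by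
            gcongr
            linarith
          _ = _ := one_mul _
      have g2 : (1 + min 1 ((c - 1) / 2)) * Real.log n ≤ (1 - κ / 2) * d n := by
        calc (1 + min 1 ((c - 1) / 2)) * Real.log n ≤ (1 + (c - 1) / 2) * Real.log n := by
              gcongr
              exact min_le_right _ _
          _ = (1 - κ / 2) * (c * Real.log n) := by linear_combination (Real.log n / 2) * hcκ
          _ ≤ _ := by
              have : 0 ≤ 1 - κ / 2 := by linarith
              gcongr
      linarith
    · have g1 := Real.exp_one_lt_d9
      have g2 : (1 + min 1 ((c - 1) / 2)) * Real.log n ≤ 2 * d n := by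
        have := min_le_left 1 ((c - 1) / 2)
        nlinarith
      nlinarith [mul_nonneg hε.le hd0]
  · refine ⟨1, one_pos, ?_⟩
    -- Both tails have exponent -ε²d/4 at parameter ε/2, hence at most -2 log n.
    filter_upwards [hω.bound (c := ε ^ 2 / 8) (by positivity), hd1, hlog,
      eventually_gt_atTop 0] with n h1 h2 h3 hn w
    have hd0 : 0 ≤ d n := h3.trans h2
    rw [Real.norm_of_nonneg h3, Real.norm_of_nonneg hd0] at h1
    have hp' := (abs_le.1 (Real.abs_exp_sub_one_sub_id_le (x := ε / 2)
      (by rw [abs_le]; constructor <;> linarith))).2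
    have hn' := (abs_le.1 (Real.abs_exp_sub_one_sub_id_le (x := -(ε / 2))
      (by rw [abs_le]; constructor <;> linarith))).2
    refine real_not_deg_le (p n) w (t := ε / 2) (u := ε / 2) (eq_card_mul (hp n) hn)
      (by positivity) (by positivity) ?_ ?_
    · nlinarith
    · nlinarith
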